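/- Let $R$ be a nonzero commutative Noetherian ring, $\operatorname{mod} R$ its category of finitely generated modules, $\operatorname{Min}(R)$ its (finite) set of minimal primes, and $\operatorname{Ass}(R)$ the set of associated primes of $R$ as an $R$-module. For an object $G$ of $D^b(\operatorname{mod} R)$ let $\operatorname{thick}^1(G)$ consist of the direct summands of finite direct sums of shifts of $G$, and for $n\ge 2$ let $\operatorname{thick}^n(G)$ consist of the direct summands of objects $E$ in distinguished triangles $A\to E\to B\to A[1]$ with $A\in\operatorname{thick}^{n-1}(G)$ and $B\in\operatorname{thick}^1(G)$. The Rouquier dimension $\dim D^b(\operatorname{mod} R)\in\mathbb{N}\cup\{\infty\}$ is the smallest $n\ge 0$ such that $\operatorname{thick}^{n+1}(G)=D^b(\operatorname{mod} R)$ for some object $G$, and $\infty$ if there is no such $n$. For an Artinian local ring $(A,\mathfrak m)$ let $\ell\ell(A)=\inf\{n\ge 0:\mathfrak m^n=0\}$ be its Loewy length. 1. If $\operatorname{Ass}(R)=\operatorname{Min}(R)$, then $$\dim D^b(\operatorname{mod} R)\le\Big(\sum_{\mathfrak p\in\operatorname{Min}(R)}\ell\ell(R_{\mathfrak p})\Big)\sup_{\mathfrak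 p\in\operatorname{Min}(R)}\{1+\dim D^b(\operatorname{mod} R/\mathfrak p)\}-1.$$ 2. If $R$ is reduced, then $$\dim D^b(\operatorname{mod} R)\le|\operatorname{Min}(R)|\sup_{\mathfrak p\in\operatorname{Min}(R)}\{1+\dim D^b(\operatorname{mod} R/\mathfrak p)\}-1.$$ 3. If $R$ is a Stanley–Reisner ring, i.e. $R\cong k[x_1,\dots,x_n]/I_\Delta$ for a field $k$, an integer $n\ge 0$ and a simplicial complex $\Delta$ on $\{1,\dots,n\}$ (with $\varnothing\in\Delta$), where $I_\Delta$ is generated by the monomials $\prod_{i\in s}x_i$ with $s\subseteq\{1,\dots,n\}$ and $s\notin\Delta$, then $$\dim D^b(\operatorname{mod} R)\le|\operatorname{Min}(R)|\,(1+\dim R)-1,$$ where $\dim R$ is the Krull dimension. -/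

import Mathlib

open CategoryTheory

universe u

/-- The Rouquier dimension of a triangulated category `T`: the least `n` for which there is an
object `G` with `thick^(n+1) G = T`, as an element of `ℕ∞`; it is `⊤` when `T` has no strong
generator.

Here `thick^(n+1) G` is Mathlib's `triangEnvelopeIter n` of the one-object property `G`:
`triangEnvelopeIter 0` is the class `thick^1 G` of direct summands of finite direct sums of shifts
of `G`, and `triangEnvelopeIter (n + 1)` is the class of direct summands of objects `E` in a
distinguished triangle `A ⟶ E ⟶ B ⟶ A⟦1⟧` with `A` in `triangEnvelopeIter n` and `B` in
`triangEnvelopeIter 0` (see `ObjectProperty.triangEnvelopeIter_zero` and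
`ObjectProperty.triangEnvelopeIter_succ'`). -/
noncomputable def rouquierDim (T : Type*) [Category* T] [Limits.HasZeroObject T] [HasShift T ℤ]
    [Preadditive T] [∀ n : ℤ, (shiftFunctor T n).Additive] [Pretriangulated T] : ℕ∞ :=
  ⨅ (G : T) (n : ℕ) (_ : (ObjectProperty.singleton G).triangEnvelopeIter n = ⊤), (n : ℕ∞)

/-- `dim D^b(mod R)` for a noetherian ring `R`: the Rouquier dimension of the bounded derived
category of the abelian category of finitely generated `R`-modules. -/
noncomputable def dimDbMod (R : Type u) [CommRing R] [IsNoetherianRing R] : ℕ∞ :=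
  letI := HasDerivedCategory.standard (FGModuleCat.{u} R)
  rouquierDim (DerivedCategory.Bounded (FGModuleCat.{u} R))

/-- The Loewy length `ℓℓ(A) = inf {n : 𝔪^n = 0}` of a local ring `A` with maximal ideal `𝔪`; it is
`⊤` when no power of `𝔪` vanishes. -/
noncomputable def loewyLength (A : Type*) [CommRing A] [IsLocalRing A] : ℕ∞ :=
  ⨅ (n : ℕ) (_ : IsLocalRing.maximalIdeal A ^ n = ⊥), (n : ℕ∞)

/-- Minimal primes are prime. -/
instance minimalPrimes_subtype_isPrime {R : Type*} [CommRing R] (p : minimalPrimes R) :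
    (p : Ideal R).IsPrime :=
  Ideal.IsMinimalPrime.isPrime p.2

/-- The Stanley-Reisner ideal of a simplicial complex `Δ` on the vertex set `Fin n`: the ideal of
`k[x_0, …, x_(n-1)]` generated by the squarefree monomials `∏_{i ∈ s} x_i` of the non-faces `s`
of `Δ`. The faces of a `PreAbstractSimplicialComplex` are its nonempty ones, and the empty set
is tacitly a face, so that `s` runs over nonempty sets. Vertices `i` with `{i} ∉ Δ` are allowed. -/
noncomputable def stanleyReisnerIdeal (k : Type*) [Field k] {n : ℕ}
    (Δ : PreAbstractSimplicialComplex (Fin n)) : Ideal (MvPolynomial (Fin n) k) :=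
  Ideal.span {f | ∃ s : Finset (Fin n), s.Nonempty ∧ s ∉ Δ ∧ f = ∏ i ∈ s, MvPolynomial.X i}

/-- `R` is a Stanley-Reisner ring: it is isomorphic, as a ring, to the quotient of a polynomial
ring over a field `k` by the Stanley-Reisner ideal of a finite simplicial complex. Since `k` embeds
into `R`, it is no restriction to take `k` in the universe of `R`. -/
def IsStanleyReisnerRing (R : Type u) [CommRing R] : Prop :=
  ∃ (k : Type u) (_ : Field k) (n : ℕ) (Δ : PreAbstractSimplicialComplex (Fin n)),
    Nonempty (R ≃+* MvPolynomial (Fin n) k ⧸ stanleyReisnerIdeal k Δ)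

/-! ### Generation in triangulated categories. -/

section Generation

open Limits Pretriangulated ObjectProperty

variable {C : Type*} [Category* C] [HasZeroObject C] [HasShift C ℤ] [Preadditive C]
  [∀ n : ℤ, (shiftFunctor C n).Additive] [Pretriangulated C]
  {D : Type*} [Category* D] [HasZeroObject D] [HasShift D ℤ] [Preadditive D]
  [∀ n : ℤ, (shiftFunctor D n).Additive] [Pretriangulated D]

/-! Everything rests on a vanishing product of ideals `I₁ ⋯ Iₘ = 0`. For a bounded complex `K` of
finitely generated modules, `K ⧸ I₁K` is a complex over `R ⧸ I₁`, and the subcomplex `I₁K` is killed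
by `I₂ ⋯ Iₘ`. Peeling off one ideal at a time builds `K` from `m` complexes over the quotients. If
each quotient has Rouquier dimension at most `n`, then `m * (n + 1)` steps suffice, with one
generator that does not depend on `K` (`exists_thickLevel_of_isAnnihilatedBy`).

It remains to choose the ideals. If `Ass = Min`, the product of the minimal primes, each raised to
its local Loewy length, vanishes, because this can be tested at the associated primes
(`prod_minimalPrimes_pow_eq_bot`). If `R` is reduced, the minimal primes themselves have product
zero.

A Stanley–Reisner ring is reduced, and its quotients by minimal primes are polynomial rings in `d ≤
dim R` variables. These have global dimension at most `d` (`hasProjectiveDimensionLT_polynomial`),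
and Rouquier dimension is bounded by global dimension: resolving the homology of a complex by
projectives lowers its projective dimension by one per step
(`Bounded.triangEnvelopeIter_of_hasProjectiveDimensionLT`). -/

/-- The Rouquier dimension is at most `n` iff some object generates in `n` steps. -/
theorem rouquierDim_le_iff (n : ℕ) :
    rouquierDim C ≤ n ↔ ∃ G : C, (ObjectProperty.singleton G).triangEnvelopeIter n = ⊤ := by
  constructor
  · intro h
    by_contra! hG
    have : ((n + 1 : ℕ) : ℕ∞) ≤ rouquierDim C := by
      refine le_iInf fun G => le_iInf fun m => le_iInf fun hm => ?_
      by_contra! hlt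
      have hmn : m ≤ n := by
        have : m < n + 1 := by exact_mod_cast hlt
        lia
      exact hG G (top_le_iff.1 (hm ▸ monotone'_triangEnvelopeIter _ hmn))
    have := this.trans h
    norm_cast at this
    lia
  · rintro ⟨G, hG⟩
    exact iInf_le_of_le G (iInf_le_of_le n (iInf_le_of_le hG le_rfl))

namespace CategoryTheory.ObjectProperty

instance {E : Type*} [Category* E] [HasBinaryProducts E] (P : ObjectProperty E)
    [P.IsClosedUnderBinaryProducts] : P.retractClosure.IsClosedUnderBinaryProducts where
  limitsOfShape_le := by
    rintro X ⟨p⟩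
    obtain ⟨A, hA, ⟨r⟩⟩ := p.prop_diag_obj (.mk .left)
    obtain ⟨B, hB, ⟨s⟩⟩ := p.prop_diag_obj (.mk .right)
    refine prop_of_iso _ (IsLimit.conePointUniqueUpToIso (prodIsProd _ _)
      ((IsLimit.postcomposeHomEquiv (diagramIsoPair p.diag) _).2 p.isLimit))
      (prop_retractClosure (P.prop_prod A B hA hB) ⟨prod.map r.i s.i, prod.map r.r s.r, ?_⟩)
    simp [prod.map_map]

instance {E E' : Type*} [Category* E] [Category* E'] (F : E ⥤ E') (P : ObjectProperty E')
    [P.IsStableUnderRetracts] : (P.inverseImage F).IsStableUnderRetracts where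
  of_retract r hY := P.prop_of_retract (r.map F) hY

/-- Numbers of steps add under extensions. Index `n` stands for `thick^(n+1)`, hence the extra `1`.
-/
theorem triangEnvelopeIter_of_distTriang [IsTriangulated C] (P : ObjectProperty C) {a b : ℕ}
    (T : Triangle C) (hT : T ∈ distTriang C) (h₁ : P.triangEnvelopeIter a T.obj₁)
    (h₃ : P.triangEnvelopeIter b T.obj₃) : P.triangEnvelopeIter (a + b + 1) T.obj₂ := by
  rw [add_assoc, triangEnvelopeIter_add' P rfl]
  exact le_retractClosure _ _ ⟨_, _, _, _, _, hT, h₁, h₃⟩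

instance (P : ObjectProperty C) : (P.triangEnvelopeIter 0).IsStableUnderShift ℤ := by
  rw [triangEnvelopeIter_zero]; infer_instance

instance (P : ObjectProperty C) : (P.triangEnvelopeIter 0).IsClosedUnderBinaryProducts := by
  rw [triangEnvelopeIter_zero]; infer_instance

theorem triangEnvelopeIter_le_inverseImage (F : C ⥤ D) [F.CommShift ℤ] [F.IsTriangulated]
    {P : ObjectProperty C} {Q : ObjectProperty D}
    (h : P ≤ (Q.triangEnvelopeIter 0).inverseImage F) (n : ℕ) :
    P.triangEnvelopeIter n ≤ (Q.triangEnvelopeIter n).inverseImage F := by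
  have h0 : P.triangEnvelopeIter 0 ≤ (Q.triangEnvelopeIter 0).inverseImage F := by
    rw [P.triangEnvelopeIter_zero, retractClosure_le_iff, binaryProductsClosure]
    refine limitsClosure_le ?_
    rw [shiftClosure_le_iff]
    exact h
  induction n with
  | zero => exact h0
  | succ n ih =>
    rw [triangEnvelopeIter_succ P, retractClosure_le_iff]
    rintro X ⟨Y, Z, f, g, k, hT, hY, hZ⟩
    rw [prop_inverseImage_iff, triangEnvelopeIter_succ Q]
    refine le_retractClosure _ _ ⟨_, _, _, _, _, F.map_distinguished _ hT, ?_, ih _ hZ⟩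
    rw [← triangEnvelopeIter_zero]
    exact h0 _ (by rwa [triangEnvelopeIter_zero])

theorem triangEnvelopeIter_zero_of_isZero (P : ObjectProperty C) [P.Nonempty] {X : C}
    (hX : IsZero X) : P.triangEnvelopeIter 0 X :=
  IsStableUnderRetracts.of_retract (P := P.triangEnvelopeIter 0)
    (⟨0, 0, hX.eq_of_src _ _⟩ : Retract X P.arbitrary)
    (le_triangEnvelopeIter P 0 _ P.prop_arbitrary)

theorem triangEnvelopeIter_zero_biprod (P : ObjectProperty C) {X Y : C}
    (hX : P.triangEnvelopeIter 0 X) (hY : P.triangEnvelopeIter 0 Y) :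
    P.triangEnvelopeIter 0 (X ⊞ Y) :=
  prop_of_iso _ (biprod.isoProd X Y).symm (prop_prod _ X Y hX hY)

end CategoryTheory.ObjectProperty

end Generation

/-! ### Building bounded complexes from the projective dimension of their homology. -/

section ProjectiveDimension

open Limits Pretriangulated ObjectProperty DerivedCategory ZeroObject

universe w v u'

variable {C : Type u'} [Category.{v} C] [Abelian C]

/-- Projectivity lifts `φ` through the epimorphism from cycles to homology, and a map into the
cycles is a chain map from a single complex. -/
theorem HomologicalComplex.exists_single_hom_homologyMap_eq (K : CochainComplex C ℤ) (i : ℤ)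
    {P : C} [Projective P] (φ : P ⟶ K.homology i) :
    ∃ f : (HomologicalComplex.single C (ComplexShape.up ℤ) i).obj P ⟶ K,
      HomologicalComplex.homologyMap f i =
        (HomologicalComplex.singleObjHomologySelfIso (ComplexShape.up ℤ) i P).hom ≫ φ := by
  let ψ := Projective.factorThru φ (K.homologyπ i)
  refine ⟨HomologicalComplex.mkHomFromSingle (ψ ≫ K.iCycles i) (by simp), ?_⟩
  rw [← cancel_epi (HomologicalComplex.homologyπ _ i), HomologicalComplex.homologyπ_naturality,
    HomologicalComplex.homologyπ_singleObjHomologySelfIso_hom_assoc,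
    ← Projective.factorThru_comp φ (K.homologyπ i), ← Category.assoc]
  congr 1
  rw [← cancel_mono (K.iCycles i)]
  simp [HomologicalComplex.singleObjCyclesSelfIso_hom, ψ]

theorem CategoryTheory.Functor.isIso_map_biprod_inl {E : Type*} [Category* E] [Preadditive E]
    [HasBinaryBiproducts E] (F : E ⥤ C) [F.Additive] (X Y : E) (hY : IsZero (F.obj Y)) :
    IsIso (F.map (biprod.inl : X ⟶ X ⊞ Y)) := by
  refine ⟨F.map biprod.fst, by simp [← F.map_comp], ?_⟩
  have h : F.map (biprod.snd : X ⊞ Y ⟶ Y) ≫ F.map (biprod.inr : Y ⟶ X ⊞ Y) = 0 := by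
    rw [hY.eq_of_tgt (F.map (biprod.snd : X ⊞ Y ⟶ Y)) 0, zero_comp]
  rw [← F.map_comp, ← F.map_id, ← biprod.total, F.map_add, F.map_comp biprod.snd, h, add_zero]

variable [HasDerivedCategory.{w} C]

namespace DerivedCategory

/-- The homology of a single complex in its degree. -/
noncomputable def homologySingleIso (i : ℤ) (P : C) :
    (homologyFunctor C i).obj ((singleFunctor C i).obj P) ≅ P :=
  (homologyFunctorFactors C i).app ((HomologicalComplex.single C (ComplexShape.up ℤ) i).obj P) ≪≫
    HomologicalComplex.singleObjHomologySelfIso (ComplexShape.up ℤ) i P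

theorem isZero_homology_single (i j : ℤ) (h : j ≠ i) (P : C) :
    IsZero ((homologyFunctor C j).obj ((singleFunctor C i).obj P)) :=
  (HomologicalComplex.isZero_single_obj_homology (ComplexShape.up ℤ) i P j h).of_iso
    ((homologyFunctorFactors C j).app ((HomologicalComplex.single C (ComplexShape.up ℤ) i).obj P))

theorem exists_single_hom_homologyMap_eq (X : DerivedCategory C) (i : ℤ) {P : C} [Projective P]
    (φ : P ⟶ (homologyFunctor C i).obj X) :
    ∃ f : (singleFunctor C i).obj P ⟶ X,
      (homologyFunctor C i).map f = (homologySingleIso i P).hom ≫ φ := by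
  let K := Q.objPreimage X
  let e : Q.obj K ≅ X := Q.objObjPreimageIso X
  obtain ⟨f, hf⟩ := HomologicalComplex.exists_single_hom_homologyMap_eq K i
    (φ ≫ (homologyFunctor C i).map e.inv ≫ (homologyFunctorFactors C i).hom.app _)
  let g : (singleFunctor C i).obj P ⟶ Q.obj K := Q.map f
  have hg : (homologyFunctor C i).map g =
      (homologySingleIso i P).hom ≫ φ ≫ (homologyFunctor C i).map e.inv := by
    rw [← cancel_mono ((homologyFunctorFactors C i).hom.app K)]
    refine (homologyFunctorFactors_hom_naturality f i).trans ?_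
    rw [hf]
    simp only [homologySingleIso, Category.assoc]
    exact (Category.assoc _ _ _).symm
  refine ⟨g ≫ e.hom, ?_⟩
  rw [Functor.map_comp, hg, Category.assoc, Category.assoc, ← Functor.map_comp, Iso.inv_hom_id,
    CategoryTheory.Functor.map_id, Category.comp_id]

variable (C) in
/-- The functor placing an object in degree `i` of the bounded derived category. -/
noncomputable def Bounded.singleFunctor (i : ℤ) : C ⥤ Bounded C :=
  ObjectProperty.lift _ (DerivedCategory.singleFunctor C i)
    fun _ => ⟨⟨i, inferInstance⟩, ⟨i, inferInstance⟩⟩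

/-- The object of the bounded derived category given by an object in degree `i`. -/
noncomputable abbrev Bounded.single (i : ℤ) (P : C) : Bounded C :=
  (Bounded.singleFunctor C i).obj P

instance (i : ℤ) : (Bounded.singleFunctor C i).Additive where
  map_add := by
    intro X Y f g
    exact Bounded.ι.map_injective ((DerivedCategory.singleFunctor C i).map_add (f := f) (g := g))

/-- The homology functors on the bounded derived category. -/
noncomputable abbrev Bounded.homology (i : ℤ) : Bounded C ⥤ C := Bounded.ι ⋙ homologyFunctor C i

/-- The homology of a single complex in its degree. -/
noncomputable def Bounded.homologySingleIso (i : ℤ) (P : C) :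
    (Bounded.homology i).obj (Bounded.single i P) ≅ P :=
  DerivedCategory.homologySingleIso i P

theorem Bounded.isZero_homology_single (i j : ℤ) (h : j ≠ i) (P : C) :
    IsZero ((Bounded.homology j).obj (Bounded.single i P)) :=
  DerivedCategory.isZero_homology_single i j h P

theorem Bounded.exists_single_hom_homologyMap_eq (X : Bounded C) (i : ℤ) {P : C} [Projective P]
    (φ : P ⟶ (Bounded.homology i).obj X) :
    ∃ f : Bounded.single i P ⟶ X,
      (Bounded.homology i).map f = (Bounded.homologySingleIso i P).hom ≫ φ := by
  obtain ⟨f, hf⟩ := DerivedCategory.exists_single_hom_homologyMap_eq X.obj i φ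
  exact ⟨ObjectProperty.homMk f, hf⟩

theorem Bounded.exists_isZero_homology (X : Bounded C) :
    ∃ s : Finset ℤ, ∀ i ∉ s, IsZero ((Bounded.homology i).obj X) := by
  obtain ⟨⟨a, ha⟩, ⟨b, hb⟩⟩ := X.property
  refine ⟨Finset.Icc a b, fun i hi => ?_⟩
  rw [Finset.mem_Icc, not_and_or, not_le, not_le] at hi
  rcases hi with hi | hi
  · exact (isGE_iff _ _).1 ha i hi
  · exact (isLE_iff _ _).1 hb i hi

variable {G : ObjectProperty (Bounded C)} [G.Nonempty]
  (hG : ∀ (P : C) [Projective P] (i : ℤ), G.triangEnvelopeIter 0 (Bounded.single i P))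

include hG in
-- The object is a finite sum of single complexes, added one degree at a time. A new summand has
-- homology only in its own degree, so the earlier degrees are undisturbed.
theorem Bounded.exists_hom_homologyMap_eq (X : Bounded C) (P : ℤ → C) [∀ i, Projective (P i)]
    (φ : ∀ i, P i ⟶ (Bounded.homology i).obj X) (s : Finset ℤ) :
    ∃ (Y : Bounded C) (f : Y ⟶ X), G.triangEnvelopeIter 0 Y ∧
      (∀ i ∉ s, IsZero ((Bounded.homology i).obj Y)) ∧
      ∀ i ∈ s, ∃ e : (Bounded.homology i).obj Y ≅ P i,
        (Bounded.homology i).map f = e.hom ≫ φ i := by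
  classical
  induction s using Finset.induction_on with
  | empty =>
    refine ⟨0, 0, triangEnvelopeIter_zero_of_isZero _ (isZero_zero _), fun i _ => ?_, by simp⟩
    exact Functor.map_isZero _ (isZero_zero _)
  | insert i s hi ih =>
    obtain ⟨Y, f, hY, h0, he⟩ := ih
    obtain ⟨Z, e, hZG, hZ, g, hg⟩ : ∃ (Z : Bounded C) (e : (Bounded.homology i).obj Z ≅ P i),
        G.triangEnvelopeIter 0 Z ∧ (∀ j ≠ i, IsZero ((Bounded.homology j).obj Z)) ∧
        ∃ g : Z ⟶ X, (Bounded.homology i).map g = e.hom ≫ φ i :=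
      ⟨_, Bounded.homologySingleIso i (P i), hG _ _,
        fun j hj => Bounded.isZero_homology_single i j hj (P i),
        Bounded.exists_single_hom_homologyMap_eq X i (φ i)⟩
    refine ⟨Y ⊞ Z, biprod.desc f g, triangEnvelopeIter_zero_biprod _ hY hZG, ?_, ?_⟩
    · intro j hj
      rw [Finset.mem_insert, not_or] at hj
      have := Functor.isIso_map_biprod_inl (Bounded.homology j) Y Z (hZ j hj.1)
      exact (h0 j hj.2).of_iso (asIso ((Bounded.homology j).map (biprod.inl : Y ⟶ Y ⊞ Z))).symm
    · intro j hj
      by_cases hji : j = i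
      · subst hji
        have h1 := Functor.isIso_map_biprod_inl (Bounded.homology j) Z Y (h0 j hi)
        let e₀ := asIso ((Bounded.homology j).map (biprod.inl : Z ⟶ Z ⊞ Y)) ≪≫
          (Bounded.homology j).mapIso (biprod.braiding Z Y)
        refine ⟨e₀.symm ≪≫ e, ?_⟩
        rw [Iso.trans_hom, Category.assoc, ← hg, Iso.symm_hom, Iso.eq_inv_comp]
        simp only [e₀, Iso.trans_hom, asIso_hom, Functor.mapIso_hom, ← Functor.map_comp]
        simp [biprod.lift_desc]
      · obtain ⟨e, he⟩ := he j (Finset.mem_of_mem_insert_of_ne hj hji)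
        have := Functor.isIso_map_biprod_inl (Bounded.homology j) Y Z (hZ j hji)
        refine ⟨(asIso ((Bounded.homology j).map (biprod.inl : Y ⟶ Y ⊞ Z))).symm ≪≫ e, ?_⟩
        rw [Iso.trans_hom, Category.assoc, ← he, Iso.symm_hom, Iso.eq_inv_comp, asIso_hom,
          ← Functor.map_comp, biprod.inl_desc]

/-- Surjectivity of `mor₁` on homology forces `mor₂` to vanish there, so the long exact sequence
breaks up. The homology of the cone is then a syzygy, shifted by one degree. -/
theorem shortExact_of_epi_homologyMap (T : Triangle (DerivedCategory C)) (hT : T ∈ distTriang _)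
    (h : ∀ i, Epi ((homologyFunctor C i).map T.mor₁)) (i : ℤ) :
    (ShortComplex.mk _ _ (HomologySequence.δ_comp T hT i (i + 1))).ShortExact where
  exact := HomologySequence.exact₁ T hT i (i + 1)
  mono_f := (HomologySequence.exact₃ T hT i (i + 1)).mono_g
    ((HomologySequence.epi_homologyMap_mor₁_iff T hT i).1 (h i))
  epi_g := h (i + 1)

include hG in
theorem Bounded.triangEnvelopeIter_of_hasProjectiveDimensionLT [EnoughProjectives C] (n : ℕ)
    (X : Bounded C) (hX : ∀ i, HasProjectiveDimensionLT ((Bounded.homology i).obj X) (n + 1)) :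
    G.triangEnvelopeIter n X := by
  induction n generalizing X with
  | zero =>
    obtain ⟨s, hs⟩ := Bounded.exists_isZero_homology X
    -- All homology is projective here, so the cover can be taken to be the homology itself and `f`
    -- becomes an isomorphism.
    obtain ⟨Y, f, hY, h0, he⟩ := Bounded.exists_hom_homologyMap_eq hG X
      (fun i => (Bounded.homology i).obj X) (fun i => 𝟙 _) s
    have hf : IsIso (Bounded.ι.map f) := by
      rw [DerivedCategory.isIso_iff]
      intro i
      by_cases hi : i ∈ s
      · obtain ⟨e, he⟩ := he i hi
        change IsIso ((Bounded.homology i).map f)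
        rw [he]
        infer_instance
      · exact ⟨0, (h0 i hi).eq_of_src _ _, (hs i hi).eq_of_src _ _⟩
    have := isIso_of_reflects_iso f Bounded.ι
    exact prop_of_iso _ (asIso f) hY
  | succ n ih =>
    obtain ⟨s, hs⟩ := Bounded.exists_isZero_homology X
    obtain ⟨Y, f, hY, h0, he⟩ := Bounded.exists_hom_homologyMap_eq hG X
      (fun i => Projective.over ((Bounded.homology i).obj X)) (fun i => Projective.π _) s
    obtain ⟨Z, g, h, hT⟩ := distinguished_cocone_triangle f
    have hT' := Bounded.ι.map_distinguished _ hT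
    have hproj : ∀ i, Projective ((Bounded.homology i).obj Y) := by
      intro i
      by_cases hi : i ∈ s
      · obtain ⟨e, -⟩ := he i hi
        exact Projective.of_iso e.symm inferInstance
      · exact Projective.of_iso (h0 i hi).isoZero.symm inferInstance
    have hse := shortExact_of_epi_homologyMap _ hT' (fun i => by
      change Epi ((Bounded.homology i).map f)
      by_cases hi : i ∈ s
      · obtain ⟨e, he⟩ := he i hi
        rw [he]
        infer_instance
      · exact ⟨fun _ _ _ => (hs i hi).eq_of_src _ _⟩)
    have hpd : ∀ i, HasProjectiveDimensionLT ((Bounded.homology i).obj Y) (n + 1) := fun i =>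
      have := hproj i
      hasProjectiveDimensionLT_of_ge _ 1 _ (by lia)
    -- `Y` costs one step; the homology of the cone `Z` in degree `i` is a syzygy of that of `X` in
    -- degree `i + 1`, so induction applies to `Z`.
    have := triangEnvelopeIter_of_distTriang G (a := 0) (b := n) _ hT hY (ih Z fun i =>
      (hse i).hasProjectiveDimensionLT_X₁ (n + 1) (hpd (i + 1)) (hX (i + 1)))
    simpa using this

end DerivedCategory

end ProjectiveDimension

/-! ### Rouquier dimension is at most global dimension. -/

section ModuleCategories

open Limits Pretriangulated ObjectProperty DerivedCategory

namespace CategoryTheory.ObjectProperty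

variable {C : Type*} [Category* C] [HasZeroObject C] [HasShift C ℤ] [Preadditive C]
  [∀ n : ℤ, (shiftFunctor C n).Additive] [Pretriangulated C]

theorem exists_triangEnvelopeIter_zero_factorization (P : ObjectProperty C) [P.Nonempty] {X : C}
    {κ : Type*} (s : Finset κ) (A : κ → C) (hA : ∀ k, P.triangEnvelopeIter 0 (A k))
    (f : ∀ k, X ⟶ A k) (g : ∀ k, A k ⟶ X) :
    ∃ (Z : C) (i : X ⟶ Z) (r : Z ⟶ X), P.triangEnvelopeIter 0 Z ∧ i ≫ r = ∑ k ∈ s, f k ≫ g k := by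
  classical
  induction s using Finset.induction_on with
  | empty => exact ⟨P.arbitrary, 0, 0, P.le_triangEnvelopeIter 0 _ P.prop_arbitrary, by simp⟩
  | insert k s hk ih =>
    obtain ⟨Z, i, r, hZ, h⟩ := ih
    refine ⟨A k ⊞ Z, biprod.lift (f k) i, biprod.desc (g k) r,
      triangEnvelopeIter_zero_biprod _ (hA k) hZ, ?_⟩
    rw [biprod.lift_desc, h, Finset.sum_insert hk]

theorem triangEnvelopeIter_zero_of_sum_eq_id (P : ObjectProperty C) [P.Nonempty] {X : C} {κ : Type*}
    [Fintype κ] (A : κ → C) (hA : ∀ k, P.triangEnvelopeIter 0 (A k))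
    (f : ∀ k, X ⟶ A k) (g : ∀ k, A k ⟶ X) (h : ∑ k, f k ≫ g k = 𝟙 X) :
    P.triangEnvelopeIter 0 X := by
  obtain ⟨Z, i, r, hZ, hir⟩ :=
    P.exists_triangEnvelopeIter_zero_factorization Finset.univ A hA f g
  exact IsStableUnderRetracts.of_retract ⟨i, r, hir.trans h⟩ hZ

end CategoryTheory.ObjectProperty

namespace FGModuleCat

variable {S : Type u} [CommRing S]

theorem epi_iff_surjective [IsNoetherianRing S] {M N : FGModuleCat.{u} S} (f : M ⟶ N) :
    Epi f ↔ Function.Surjective f := by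
  constructor
  · intro h
    exact (ModuleCat.epi_iff_surjective ((forget₂ (FGModuleCat S) (ModuleCat S)).map f)).1
      inferInstance
  · intro h
    have : Epi ((forget₂ (FGModuleCat S) (ModuleCat S)).map f) :=
      (ModuleCat.epi_iff_surjective _).2 h
    exact (forget₂ (FGModuleCat S) (ModuleCat S)).epi_of_epi_map this

theorem projective_of_projective_obj [IsNoetherianRing S] (M : FGModuleCat.{u} S)
    (h : Projective M.obj) :
    Projective M where
  factors {E X} f e he := by
    have : Epi ((forget₂ (FGModuleCat S) (ModuleCat S)).map e) := inferInstance
    refine ⟨ObjectProperty.homMk (Projective.factorThru (P := M.obj)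
      ((forget₂ (FGModuleCat S) (ModuleCat S)).map f)
      ((forget₂ (FGModuleCat S) (ModuleCat S)).map e)), ?_⟩
    apply (forget₂ (FGModuleCat S) (ModuleCat S)).map_injective
    exact Projective.factorThru_comp (P := M.obj) _ _

theorem exists_epi_free [IsNoetherianRing S] (M : FGModuleCat.{u} S) :
    ∃ (n : ℕ) (f : FGModuleCat.of S (Fin n → S) ⟶ M), Epi f := by
  obtain ⟨n, f, hf⟩ := Module.Finite.exists_fin' S M
  exact ⟨n, FGModuleCat.ofHom f, (epi_iff_surjective _).2 hf⟩

theorem projective_obj_free (n : ℕ) : Projective (FGModuleCat.of S (Fin n → S)).obj :=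
  (IsProjective.iff_projective (R := S) (Fin n → S)).1 inferInstance

instance [IsNoetherianRing S] : EnoughProjectives (FGModuleCat.{u} S) where
  presentation M := by
    obtain ⟨n, f, hf⟩ := exists_epi_free M
    exact ⟨{ p := _, projective := projective_of_projective_obj _ (projective_obj_free n), f := f }⟩

/-- Over a noetherian ring a syzygy of a finite free cover is again finitely generated, so dimension
shifting runs in parallel in both categories. -/
theorem hasProjectiveDimensionLT_of_obj [IsNoetherianRing S] (n : ℕ) (M : FGModuleCat.{u} S)
    (h : HasProjectiveDimensionLT M.obj (n + 1)) : HasProjectiveDimensionLT M (n + 1) := by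
  induction n generalizing M with
  | zero =>
    have := projective_of_projective_obj M (projective_iff_hasProjectiveDimensionLT_one.2 h)
    infer_instance
  | succ n ih =>
    obtain ⟨k, f, hf⟩ := exists_epi_free M
    let T := ShortComplex.mk (kernel.ι f) f (by simp)
    have hT : T.ShortExact := { exact := ShortComplex.exact_kernel f }
    have hT' := hT.map_of_exact (forget₂ (FGModuleCat S) (ModuleCat S))
    rw [hT.hasProjectiveDimensionLT_X₃_iff n
      (projective_of_projective_obj _ (projective_obj_free k))]
    exact ih _ ((hT'.hasProjectiveDimensionLT_X₃_iff n (projective_obj_free k)).1 h)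

/-- The dual basis lemma. In this form any additive functor carries it over, exhibiting the image of
`M` as a retract of a finite sum of images of `S`. -/
theorem exists_sum_eq_id_of_projective [IsNoetherianRing S] (M : FGModuleCat.{u} S) [Projective M] :
    ∃ (n : ℕ) (f : Fin n → (M ⟶ FGModuleCat.of S S)) (g : Fin n → (FGModuleCat.of S S ⟶ M)),
      ∑ k, f k ≫ g k = 𝟙 M := by
  obtain ⟨n, p, hp⟩ := exists_epi_free M
  let s := Projective.factorThru (𝟙 M) p
  let a : Fin n → (FGModuleCat.of S (Fin n → S) ⟶ FGModuleCat.of S S) := fun k =>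
    FGModuleCat.ofHom (LinearMap.proj k)
  let b : Fin n → (FGModuleCat.of S S ⟶ FGModuleCat.of S (Fin n → S)) := fun k =>
    FGModuleCat.ofHom (LinearMap.single S (fun _ => S) k)
  have hab : ∑ k, a k ≫ b k = 𝟙 _ := by
    have h := (forget₂ (FGModuleCat S) (ModuleCat S)).map_sum (fun k => a k ≫ b k) Finset.univ
    apply (forget₂ (FGModuleCat S) (ModuleCat S)).map_injective
    rw [h]
    apply ModuleCat.hom_ext
    rw [ModuleCat.hom_sum]
    exact LinearMap.ext fun x => (LinearMap.sum_apply _ _ _).trans (Finset.univ_sum_single x)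
  refine ⟨n, fun k => s ≫ a k, fun k => b k ≫ p, ?_⟩
  simp only [Category.assoc]
  rw [← Preadditive.comp_sum]
  simp only [← Category.assoc (a _)]
  rw [← Preadditive.sum_comp, hab, Category.id_comp]
  exact Projective.factorThru_comp _ _

end FGModuleCat

namespace DerivedCategory

variable {C : Type*} [Category* C] [Abelian C] [HasDerivedCategory C]

/-- Single complexes in different degrees are shifts of each other. -/
noncomputable def Bounded.singleShiftIso (i : ℤ) (P : C) :
    (Bounded.single i P)⟦i⟧ ≅ Bounded.single 0 P :=
  Bounded.ι.preimageIso ((Bounded.ι.commShiftIso i).app _ ≪≫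
    ((singleFunctors C).shiftIso i 0 i (by simp)).app P)

theorem Bounded.triangEnvelopeIter_zero_single (G : ObjectProperty (Bounded C)) (P : C)
    (h : G.triangEnvelopeIter 0 (Bounded.single 0 P)) (i : ℤ) :
    G.triangEnvelopeIter 0 (Bounded.single i P) := by
  have := prop_of_iso _ (Bounded.singleShiftIso i P).symm h
  exact ((G.triangEnvelopeIter 0).prop_shift_iff_of_isStableUnderShift _ i).1 this

end DerivedCategory

theorem dimDbMod_le_of_hasProjectiveDimensionLT (S : Type u) [CommRing S] [IsNoetherianRing S]
    (n : ℕ)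
    (h : ∀ M : ModuleCat.{u} S, HasProjectiveDimensionLT M (n + 1)) : dimDbMod S ≤ n := by
  let := HasDerivedCategory.standard (FGModuleCat.{u} S)
  refine (rouquierDim_le_iff n).2 ⟨Bounded.single 0 (FGModuleCat.of S S), ?_⟩
  rw [eq_top_iff]
  intro X _
  refine Bounded.triangEnvelopeIter_of_hasProjectiveDimensionLT (fun P _ i => ?_) n X
    (fun i => FGModuleCat.hasProjectiveDimensionLT_of_obj n _ (h _))
  obtain ⟨k, f, g, hfg⟩ := FGModuleCat.exists_sum_eq_id_of_projective P
  let F := Bounded.singleFunctor (FGModuleCat.{u} S) i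
  refine triangEnvelopeIter_zero_of_sum_eq_id _ (fun _ => F.obj (FGModuleCat.of S S))
    (fun _ => Bounded.triangEnvelopeIter_zero_single _ _
      (le_triangEnvelopeIter _ _ _ ((singleton_iff _ _).2 rfl)) i) (fun k => F.map (f k))
      (fun k => F.map (g k)) ?_
  simp only [← F.map_comp]
  rw [← F.map_sum, hfg]
  exact F.map_id P

end ModuleCategories

/-! ### Global dimension of polynomial rings. -/

section PolynomialDimension

open Limits Polynomial TensorProduct

theorem ModuleCat.shortExact_ofHom {R : Type*} [Ring R] {L M N : Type u} [AddCommGroup L]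
    [AddCommGroup M]
    [AddCommGroup N] [Module R L] [Module R M] [Module R N] (f : L →ₗ[R] M) (g : M →ₗ[R] N)
    (hf : Function.Injective f) (hg : Function.Surjective g) (h : Function.Exact f g) :
    (ShortComplex.mk (ModuleCat.ofHom f) (ModuleCat.ofHom g)
      (by rw [← ModuleCat.ofHom_comp, h.linearMap_comp_eq_zero]; rfl)).ShortExact :=
  ModuleCat.shortComplex_shortExact _ h hf hg

theorem hasProjectiveDimensionLT_baseChange {R : Type u} [CommRing R] (A : Type u) [CommRing A]
    [Algebra R A] [Module.Flat R A] (n : ℕ) (N : Type u) [AddCommGroup N] [Module R N]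
    (h : HasProjectiveDimensionLT (ModuleCat.of R N) (n + 1)) :
    HasProjectiveDimensionLT (ModuleCat.of A (A ⊗[R] N)) (n + 1) := by
  induction n generalizing N with
  | zero =>
    rw [zero_add, ← projective_iff_hasProjectiveDimensionLT_one] at h ⊢
    have := (IsProjective.iff_projective (R := R) N).2 h
    exact (IsProjective.iff_projective (R := A) (A ⊗[R] N)).1 inferInstance
  | succ n ih =>
    obtain ⟨F, _, _, hF, p, hp⟩ : ∃ (F : Type u) (_ : AddCommGroup F) (_ : Module R F),
        Module.Projective R F ∧ ∃ p : F →ₗ[R] N, Function.Surjective p :=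
      ⟨N →₀ R, inferInstance, inferInstance, inferInstance, Finsupp.linearCombination R id,
        Finsupp.linearCombination_id_surjective R N⟩
    let ι : LinearMap.ker p →ₗ[R] F := (LinearMap.ker p).subtype
    have hex : Function.Exact ι p := LinearMap.exact_subtype_ker_map p
    have hι : Function.Injective ι := (LinearMap.ker p).injective_subtype
    have h₁ := ModuleCat.shortExact_ofHom ι p hι hp hex
    have h₂ := ModuleCat.shortExact_ofHom (ι.baseChange A) (p.baseChange A)
      (Module.Flat.lTensor_preserves_injective_linearMap _ (LinearMap.ker p).injective_subtype)
      (LinearMap.lTensor_surjective A hp) (lTensor_exact A hex hp)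
    rw [h₂.hasProjectiveDimensionLT_X₃_iff n
      ((IsProjective.iff_projective (R := A) (A ⊗[R] F)).1 inferInstance)]
    exact ih _ ((h₁.hasProjectiveDimensionLT_X₃_iff n
      ((IsProjective.iff_projective (R := R) F).1 hF)).1 h)

namespace Polynomial

variable {R : Type*} [CommRing R] (M : Type*) [AddCommGroup M] [Module R M] [Module R[X] M]
  [IsScalarTower R R[X] M]

/-- Multiplication by `X ⊗ 1 - 1 ⊗ X` on `R[X] ⊗[R] M`. -/
noncomputable def tensorDiff : R[X] ⊗[R] M →ₗ[R[X]] R[X] ⊗[R] M :=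
  LinearMap.lsmul R[X] _ X - (LinearMap.lsmul R[X] M X |>.restrictScalars R).baseChange R[X]

@[simp]
theorem tensorDiff_tmul (p : R[X]) (m : M) :
    tensorDiff M (p ⊗ₜ[R] m) = (X * p) ⊗ₜ m - p ⊗ₜ[R] ((X : R[X]) • m) := by
  simp [tensorDiff, TensorProduct.smul_tmul']

/-- The action map `R[X] ⊗[R] M → M`. -/
noncomputable def tensorAct : R[X] ⊗[R] M →ₗ[R[X]] M :=
  LinearMap.liftBaseChange R[X] (LinearMap.id : M →ₗ[R] M)

@[simp]
theorem tensorAct_tmul (p : R[X]) (m : M) : tensorAct M (p ⊗ₜ[R] m) = p • m := by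
  simp [tensorAct]

theorem tensorAct_surjective : Function.Surjective (tensorAct (R := R) M) := fun m =>
  ⟨1 ⊗ₜ m, by simp⟩

/-- An element `t` of the kernel has coefficients satisfying `tᵢ = X • tᵢ₊₁`. Only finitely many are
nonzero, so descending induction kills them all. -/
theorem tensorDiff_injective : Function.Injective (tensorDiff (R := R) M) := by
  rw [injective_iff_map_eq_zero]
  intro t ht
  let e : R[X] ⊗[R] M ≃ₗ[R] (ℕ →₀ M) :=
    TensorProduct.equivFinsuppOfBasisLeft (Polynomial.basisMonomials R)
  have key : ∀ (t : R[X] ⊗[R] M) (i : ℕ), e (tensorDiff M t) (i + 1) =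
      e t i - (X : R[X]) • e t (i + 1) := by
    intro t i
    induction t with
    | zero => simp
    | add a b ha hb => simp only [map_add, Finsupp.add_apply, ha, hb, smul_add]; abel
    | tmul p m =>
      simp only [tensorDiff_tmul, map_sub, Finsupp.sub_apply, e,
        TensorProduct.equivFinsuppOfBasisLeft_apply_tmul_apply]
      have hc : ∀ (q : R[X]) (j : ℕ), (Polynomial.basisMonomials R).repr q j = q.coeff j :=
        fun q j => rfl
      rw [hc, hc, hc, coeff_X_mul, algebra_compatible_smul R[X] (p.coeff (i + 1)) (X • m),
        algebra_compatible_smul R[X] (p.coeff (i + 1)) m, smul_comm]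
  have hz : ∀ k i, (∀ j, i + k ≤ j → e t j = 0) → e t i = 0 := by
    intro k
    induction k with
    | zero => exact fun i h => h i le_rfl
    | succ k ih =>
      intro i h
      have h1 := key t i
      rw [ht, map_zero, Finsupp.zero_apply, ih (i + 1) fun j hj => h j (by lia), smul_zero,
        sub_zero] at h1
      exact h1.symm
  rw [← e.map_eq_zero_iff]
  ext i
  refine hz ((e t).support.sup id + 1) i fun j hj => ?_
  by_contra hne
  have := Finset.le_sup (f := id) (Finsupp.mem_support_iff.2 hne)
  simp only [id] at this
  lia

/-- Modulo the range a factor `X` crosses the tensor sign, so by induction on the degree all of `p`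
does. This gives the nontrivial half of exactness. -/
theorem sub_tmul_mem_range_tensorDiff (p : R[X]) (m : M) :
    p ⊗ₜ[R] m - 1 ⊗ₜ[R] (p • m) ∈ LinearMap.range (tensorDiff (R := R) M) := by
  induction p using Polynomial.induction_on' generalizing m with
  | add p q hp hq =>
    rw [TensorProduct.add_tmul, add_smul, TensorProduct.tmul_add, add_sub_add_comm]
    exact add_mem (hp m) (hq m)
  | monomial k r =>
    induction k generalizing m with
    | zero =>
      have : monomial 0 r = r • (1 : R[X]) := by
        rw [monomial_zero_left, ← algebraMap_eq, Algebra.algebraMap_eq_smul_one]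
      rw [this, TensorProduct.smul_tmul, smul_assoc, one_smul, sub_self]
      exact zero_mem _
    | succ k ih =>
      have h : monomial (k + 1) r = X * monomial k r := by
        rw [X_mul_monomial]
      have h2 := add_mem (LinearMap.mem_range_self (tensorDiff M) (monomial k r ⊗ₜ[R] m))
        (ih ((X : R[X]) • m))
      rw [tensorDiff_tmul, ← h, sub_add_sub_cancel, ← mul_smul, monomial_mul_X] at h2
      exact h2

theorem exact_tensorDiff_tensorAct : Function.Exact (tensorDiff (R := R) M) (tensorAct M) := by
  rw [LinearMap.exact_iff]
  apply le_antisymm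
  · have key : ∀ t : R[X] ⊗[R] M, t - 1 ⊗ₜ[R] tensorAct M t ∈
        LinearMap.range (tensorDiff (R := R) M) := by
      intro t
      induction t with
      | zero => simp
      | tmul p m => simpa using sub_tmul_mem_range_tensorDiff M p m
      | add a b ha hb =>
        rw [map_add, TensorProduct.tmul_add, add_sub_add_comm]
        exact add_mem ha hb
    intro t ht
    simpa [LinearMap.mem_ker.1 ht] using key t
  · rintro _ ⟨t, rfl⟩
    rw [LinearMap.mem_ker]
    induction t with
    | zero => simp
    | tmul p m => simp [mul_comm X, mul_smul]
    | add a b ha hb => rw [map_add, map_add, ha, hb, add_zero]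

end Polynomial

/-- The exact sequence `0 → R[X] ⊗ M → R[X] ⊗ M → M → 0` resolves `M` by flat base changes of
`R`-modules, which costs one extra dimension. -/
theorem hasProjectiveDimensionLT_polynomial (R : Type u) [CommRing R] (n : ℕ)
    (h : ∀ M : ModuleCat.{u} R, HasProjectiveDimensionLT M (n + 1)) (M : ModuleCat.{u} R[X]) :
    HasProjectiveDimensionLT M (n + 2) := by
  let : Module R M := Module.compHom M (C : R →+* R[X])
  have : IsScalarTower R R[X] M := .of_algebraMap_smul fun r x => rfl
  have hB := hasProjectiveDimensionLT_baseChange R[X] n M (h _)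
  have hE := ModuleCat.shortExact_ofHom _ _ (Polynomial.tensorDiff_injective (R := R) M)
    (Polynomial.tensorAct_surjective M) (Polynomial.exact_tensorDiff_tensorAct M)
  exact hE.hasProjectiveDimensionLT_X₃ (n + 1) hB
    (hasProjectiveDimensionLT_of_ge _ (n + 1) _ (by lia))

theorem hasProjectiveDimensionLT_of_ringEquiv {R S : Type u} [CommRing R] [CommRing S]
    (e : R ≃+* S) (n : ℕ)
    (h : ∀ M : ModuleCat.{u} R, HasProjectiveDimensionLT M (n + 1)) (M : ModuleCat.{u} S) :
    HasProjectiveDimensionLT M (n + 1) := by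
  let := RingHomInvPair.of_ringEquiv e
  let := RingHomInvPair.of_ringEquiv e.symm
  let N := (ModuleCat.restrictScalars (RingHomClass.toRingHom e)).obj M
  have := h N
  let e' : N ≃ₛₗ[RingHomClass.toRingHom e] M :=
    { toFun := fun x => x
      invFun := fun x => x
      map_add' := fun _ _ => rfl
      map_smul' := fun _ _ => rfl }
  exact ModuleCat.hasProjectiveDimensionLE_of_semiLinearEquiv e e' n

theorem hasProjectiveDimensionLT_field (k : Type u) [Field k] (M : ModuleCat.{u} k) :
    HasProjectiveDimensionLT M 1 :=
  have : Module.Free k M := Module.Free.of_divisionRing k M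
  projective_iff_hasProjectiveDimensionLT_one.1
    ((IsProjective.iff_projective (R := k) M).1 Module.Projective.of_free)

theorem hasProjectiveDimensionLT_mvPolynomial (k : Type u) [Field k] (n : ℕ)
    (M : ModuleCat.{u} (MvPolynomial (Fin n) k)) :
    HasProjectiveDimensionLT M (n + 1) := by
  induction n with
  | zero =>
    exact hasProjectiveDimensionLT_of_ringEquiv (MvPolynomial.isEmptyRingEquiv k (Fin 0)).symm 0
      (hasProjectiveDimensionLT_field k) M
  | succ n ih =>
    exact hasProjectiveDimensionLT_of_ringEquiv (MvPolynomial.finSuccEquiv k n).symm.toRingEquiv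
      (n + 1)
      (hasProjectiveDimensionLT_polynomial _ n ih) M

theorem dimDbMod_le_of_ringEquiv_mvPolynomial (S : Type u) [CommRing S] [IsNoetherianRing S]
    (k : Type u) [Field k]
    (n : ℕ) (e : S ≃+* MvPolynomial (Fin n) k) : dimDbMod S ≤ n :=
  dimDbMod_le_of_hasProjectiveDimensionLT S n
    (hasProjectiveDimensionLT_of_ringEquiv e.symm n (hasProjectiveDimensionLT_mvPolynomial k n))

end PolynomialDimension

/-! ### Stanley–Reisner ideals and their minimal primes. -/

section StanleyReisner

open MvPolynomial

theorem MvPolynomial.ker_killCompl {σ k : Type*} [CommRing k] (F : Set σ) :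
    RingHom.ker (killCompl (R := k) (Subtype.val_injective (p := (· ∈ F)))) =
      Ideal.span (X '' Fᶜ : Set (MvPolynomial σ k)) := by
  set φ := killCompl (R := k) (Subtype.val_injective (p := (· ∈ F))) with hφ
  set I := Ideal.span (X '' Fᶜ : Set (MvPolynomial σ k))
  have hX : ∀ i ∉ F, φ (X i) = 0 := by
    intro i hi
    simp [φ, killCompl, hi]
  apply le_antisymm
  -- Killing the variables outside `F` and including back changes nothing modulo `I`, so the
  -- quotient map factors through `φ`.
  · have key : ((Ideal.Quotient.mkₐ k I).comp (rename Subtype.val)).comp φ =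
        Ideal.Quotient.mkₐ k I := by
      apply MvPolynomial.algHom_ext
      intro i
      by_cases hi : i ∈ F
      · have : φ (X i) = X ⟨i, hi⟩ := by
          rw [← killCompl_rename_app (Subtype.val_injective (p := (· ∈ F))) (X ⟨i, hi⟩), rename_X]
        simp [this]
      · rw [AlgHom.comp_apply, hX i hi, map_zero, eq_comm]
        exact Ideal.Quotient.eq_zero_iff_mem.2 (Ideal.subset_span ⟨i, hi, rfl⟩)
    intro x hx
    have := AlgHom.congr_fun key x
    rw [AlgHom.comp_apply, (RingHom.mem_ker).1 hx, map_zero, eq_comm] at this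
    exact Ideal.Quotient.eq_zero_iff_mem.1 this
  · rw [Ideal.span_le]
    rintro _ ⟨i, hi, rfl⟩
    exact hX i hi

theorem MvPolynomial.killCompl_surjective {σ τ k : Type*} [CommRing k] {f : σ → τ}
    (hf : Function.Injective f) : Function.Surjective (killCompl (R := k) hf) := fun p =>
  ⟨rename f p, killCompl_rename_app hf p⟩

theorem MvPolynomial.isPrime_span_X_image {σ k : Type*} [CommRing k] [IsDomain k] (F : Set σ) :
    (Ideal.span (X '' F : Set (MvPolynomial σ k))).IsPrime := by
  rw [← compl_compl F, ← ker_killCompl]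
  exact RingHom.ker_isPrime _

theorem MvPolynomial.exists_quotient_span_X_image_equiv {k : Type*} [CommRing k] {n : ℕ}
    (F : Set (Fin n)) :
    ∃ d : ℕ, Nonempty
      ((MvPolynomial (Fin n) k ⧸ Ideal.span (X '' F : Set (MvPolynomial (Fin n) k))) ≃+*
      MvPolynomial (Fin d) k) := by
  classical
  rw [← compl_compl F, ← ker_killCompl]
  exact ⟨_, ⟨(RingHom.quotientKerEquivOfSurjective (killCompl_surjective _)).trans
    (renameEquiv k (Fintype.equivFin (Fᶜ : Set (Fin n)))).toRingEquiv⟩⟩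

variable {k : Type*} [Field k] {n : ℕ} (Δ : PreAbstractSimplicialComplex (Fin n))

theorem stanleyReisnerIdeal_le_span {F : Finset (Fin n)} (hF : F.Nonempty → F ∈ Δ) :
    stanleyReisnerIdeal k Δ ≤ Ideal.span (X '' (F : Set (Fin n))ᶜ) := by
  rw [stanleyReisnerIdeal, Ideal.span_le]
  rintro _ ⟨s, hs, hsΔ, rfl⟩
  obtain ⟨i, his, hiF⟩ : ∃ i ∈ s, i ∉ F := by
    by_contra! h
    have h' : s ⊆ F := h
    exact hsΔ ((Δ.isRelLowerSet_faces (hF (hs.mono h'))).2 h' hs)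
  exact Ideal.mem_of_dvd _ (Finset.dvd_prod_of_mem _ his) (Ideal.subset_span ⟨i, hiF, rfl⟩)

/-- The ideal is the intersection of the primes attached to faces; the hypothesis `F.Nonempty → F ∈
Δ` admits the empty face. For the converse, each monomial of `f` is tested at its own support: if
this were a face, the monomial would need a variable outside its support. -/
theorem mem_stanleyReisnerIdeal_iff (f : MvPolynomial (Fin n) k) :
    f ∈ stanleyReisnerIdeal k Δ ↔ ∀ F : Finset (Fin n), (F.Nonempty → F ∈ Δ) →
      f ∈ Ideal.span (X '' (F : Set (Fin n))ᶜ) := by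
  refine ⟨fun hf F hF => stanleyReisnerIdeal_le_span Δ hF hf, fun h => ?_⟩
  rw [f.as_sum]
  refine Ideal.sum_mem _ fun m hm => ?_
  by_cases hF : m.support.Nonempty → m.support ∈ Δ
  · obtain ⟨i, hi, hne⟩ := mem_ideal_span_X_image.1 (h _ hF) m hm
    exact absurd (Finsupp.mem_support_iff.2 hne) hi
  · rw [Classical.not_imp] at hF
    refine Ideal.mem_of_dvd _ ?_ (Ideal.subset_span ⟨m.support, hF.1, hF.2, rfl⟩)
    rw [monomial_eq]
    refine Dvd.dvd.mul_left (Finset.prod_dvd_prod_of_dvd _ _ fun i hi => ?_) _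
    exact dvd_pow_self _ (Finsupp.mem_support_iff.1 hi)

theorem isRadical_stanleyReisnerIdeal : (stanleyReisnerIdeal k Δ).IsRadical := by
  rintro f ⟨m, hf⟩
  rw [mem_stanleyReisnerIdeal_iff] at hf ⊢
  exact fun F hF => (isPrime_span_X_image _).mem_of_pow_mem m (hf F hF)

theorem exists_eq_span_of_mem_minimalPrimes_stanleyReisnerIdeal {P : Ideal (MvPolynomial (Fin n) k)}
    (hP : P ∈ (stanleyReisnerIdeal k Δ).minimalPrimes) :
    ∃ F : Set (Fin n), P = Ideal.span (X '' F) := by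
  classical
  -- By primality the product of these variables lies outside `P`, so `F` is a face; minimality of
  -- `P` then identifies it with the prime of `F`.
  let F : Finset (Fin n) := {i | (X i : MvPolynomial (Fin n) k) ∉ P}
  have hprime : P.IsPrime := hP.1.1
  have hF : F.Nonempty → F ∈ Δ := by
    intro hne
    by_contra hF
    have := hP.1.2 (Ideal.subset_span ⟨F, hne, hF, rfl⟩)
    obtain ⟨i, hi, hiP⟩ := (hprime.prod_mem_iff).1 this
    exact (Finset.mem_filter.1 hi).2 hiP
  have hle : Ideal.span (X '' (F : Set (Fin n))ᶜ) ≤ P := by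
    rw [Ideal.span_le]
    rintro _ ⟨i, hi, rfl⟩
    by_contra hiP
    exact hi (by simpa [F] using hiP)
  exact ⟨_, le_antisymm (hP.2 ⟨isPrime_span_X_image _, stanleyReisnerIdeal_le_span Δ hF⟩ hle) hle⟩

theorem IsStanleyReisnerRing.isReduced {R : Type u} [CommRing R] (h : IsStanleyReisnerRing R) :
    IsReduced R := by
  obtain ⟨k, _, n, Δ, ⟨e⟩⟩ := h
  have : IsReduced (MvPolynomial (Fin n) k ⧸ stanleyReisnerIdeal k Δ) :=
    (Ideal.isRadical_iff_quotient_reduced _).1 (isRadical_stanleyReisnerIdeal Δ)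
  exact isReduced_of_injective e e.injective

theorem IsStanleyReisnerRing.exists_quotient_minimalPrime_equiv {R : Type u} [CommRing R]
    (h : IsStanleyReisnerRing R) {p : Ideal R} (hp : p ∈ minimalPrimes R) :
    ∃ (k : Type u) (_ : Field k) (d : ℕ), Nonempty (R ⧸ p ≃+* MvPolynomial (Fin d) k) := by
  obtain ⟨k, _, n, Δ, ⟨e⟩⟩ := h
  let f : MvPolynomial (Fin n) k →+* R :=
    (e.symm : _ →+* R).comp (Ideal.Quotient.mk (stanleyReisnerIdeal k Δ))
  have hf : Function.Surjective f := e.symm.surjective.comp Ideal.Quotient.mk_surjective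
  have hker : RingHom.ker f = stanleyReisnerIdeal k Δ := by
    ext x
    simp [f, RingHom.mem_ker, Ideal.Quotient.eq_zero_iff_mem]
  have hP : p.comap f ∈ (stanleyReisnerIdeal k Δ).minimalPrimes := by
    have := Ideal.minimalPrimes_comap_of_surjective hf (I := ⊥) hp
    rwa [← RingHom.ker_eq_comap_bot, hker] at this
  obtain ⟨F, hF⟩ := exists_eq_span_of_mem_minimalPrimes_stanleyReisnerIdeal Δ hP
  obtain ⟨d, ⟨e'⟩⟩ := exists_quotient_span_X_image_equiv (k := k) F
  have hg : Function.Surjective ((Ideal.Quotient.mk p).comp f) :=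
    Ideal.Quotient.mk_surjective.comp hf
  have hkg : RingHom.ker ((Ideal.Quotient.mk p).comp f) = Ideal.span (X '' F) := by
    rw [← hF, ← RingHom.comap_ker, Ideal.mk_ker]
  exact ⟨k, inferInstance, d, ⟨(RingHom.quotientKerEquivOfSurjective hg).symm.trans
    ((Ideal.quotEquivOfEq hkg).trans e')⟩⟩

end StanleyReisner

/-! ### Levels, exact functors and triangles of bounded complexes. -/

section Filtration

open Limits Pretriangulated ObjectProperty DerivedCategory

namespace CategoryTheory.ObjectProperty

variable {C : Type*} [Category* C] [HasZeroObject C] [HasShift C ℤ] [Preadditive C]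
  [∀ n : ℤ, (shiftFunctor C n).Additive] [Pretriangulated C]

/-- The objects `thick^n P`, where `thick^0 P` consists of the zero objects. -/
def thickLevel (P : ObjectProperty C) : ℕ → ObjectProperty C
  | 0 => fun X => IsZero X
  | n + 1 => P.triangEnvelopeIter n

theorem thickLevel_le_of_le {P Q : ObjectProperty C} (h : P ≤ Q.triangEnvelopeIter 0) (n : ℕ) :
    P.thickLevel n ≤ Q.thickLevel n := by
  cases n with
  | zero => exact le_rfl
  | succ n => exact triangEnvelopeIter_le_inverseImage (𝟭 C) h n

theorem thickLevel_of_distTriang [IsTriangulated C] (P : ObjectProperty C) {a b : ℕ}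
    (T : Triangle C) (hT : T ∈ distTriang C) (h₁ : P.thickLevel a T.obj₁)
    (h₃ : P.triangEnvelopeIter b T.obj₃) : P.thickLevel (a + (b + 1)) T.obj₂ := by
  cases a with
  | zero =>
    have := (T.isZero₁_iff_isIso₂ hT).1 h₁
    rw [zero_add]
    exact prop_of_iso (P.triangEnvelopeIter b) (asIso T.mor₂).symm h₃
  | succ a =>
    have := P.triangEnvelopeIter_of_distTriang T hT h₁ h₃
    rwa [show a + 1 + (b + 1) = (a + b + 1) + 1 by lia]

/-- Fullness lifts the maps; only the third needs a correction, by the isomorphism comparing the two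
shifts. -/
theorem exists_distTriang_fullSubcategory (P : ObjectProperty C) [P.IsTriangulated]
    (X Y Z : P.FullSubcategory) (f : X.obj ⟶ Y.obj) (g : Y.obj ⟶ Z.obj) (h : Z.obj ⟶ X.obj⟦(1 : ℤ)⟧)
    (hT : Triangle.mk f g h ∈ distTriang C) :
    ∃ (f' : X ⟶ Y) (g' : Y ⟶ Z) (h' : Z ⟶ X⟦(1 : ℤ)⟧),
      Triangle.mk f' g' h' ∈ distTriang P.FullSubcategory := by
  refine ⟨P.fullyFaithfulι.preimage f, P.fullyFaithfulι.preimage g,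
    P.fullyFaithfulι.preimage (h ≫ (P.ι.commShiftIso (1 : ℤ)).inv.app X), ?_⟩
  refine isomorphic_distinguished _ hT _ ?_
  refine Triangle.isoMk _ _ (Iso.refl _) (Iso.refl _) (Iso.refl _)
    ((Category.comp_id _).trans (Category.id_comp _).symm)
    ((Category.comp_id _).trans (Category.id_comp _).symm) ?_
  have h₁ : P.ι.map (P.fullyFaithfulι.preimage (h ≫ (P.ι.commShiftIso (1 : ℤ)).inv.app X)) ≫
      (P.ι.commShiftIso (1 : ℤ)).hom.app X = h := by
    rw [P.fullyFaithfulι.map_preimage]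
    erw [Category.assoc, Iso.inv_hom_id_app]
    exact Category.comp_id _
  refine (congrArg (_ ≫ ·) ((shiftFunctor C (1 : ℤ)).map_id _)).trans ?_
  exact (Category.comp_id _).trans (h₁.trans (Category.id_comp _).symm)

end CategoryTheory.ObjectProperty

section

variable {C C' : Type*} [Category* C] [Abelian C] [Category* C'] [Abelian C']

theorem CochainComplex.isStrictlyGE_map (F : C ⥤ C') [F.Additive] (K : CochainComplex C ℤ) (a : ℤ)
    [K.IsStrictlyGE a] :
    CochainComplex.IsStrictlyGE ((F.mapHomologicalComplex (ComplexShape.up ℤ)).obj K) a := by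
  rw [CochainComplex.isStrictlyGE_iff]
  exact fun i hi => F.map_isZero (K.isZero_of_isStrictlyGE a i hi)

theorem CochainComplex.isStrictlyLE_map (F : C ⥤ C') [F.Additive] (K : CochainComplex C ℤ) (a : ℤ)
    [K.IsStrictlyLE a] :
    CochainComplex.IsStrictlyLE ((F.mapHomologicalComplex (ComplexShape.up ℤ)).obj K) a := by
  rw [CochainComplex.isStrictlyLE_iff]
  exact fun i hi => F.map_isZero (K.isZero_of_isStrictlyLE a i hi)

end

namespace DerivedCategory

universe w₁ w₂ v₁ v₂ u₁ u₂

variable {C : Type u₁} [Category.{v₁} C] [Abelian C] [HasDerivedCategory.{w₁} C]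
  {C' : Type u₂} [Category.{v₂} C'] [Abelian C'] [HasDerivedCategory.{w₂} C']

/-- The object of the bounded derived category given by a bounded complex. -/
noncomputable def Bounded.ofComplex (K : CochainComplex C ℤ) (a b : ℤ) [K.IsStrictlyGE a]
    [K.IsStrictlyLE b] : Bounded C :=
  ⟨Q.obj K, ⟨a, inferInstance⟩, ⟨b, inferInstance⟩⟩

theorem Bounded.exists_iso_ofComplex (X : Bounded C) :
    ∃ (K : CochainComplex C ℤ) (a b : ℤ) (_ : K.IsStrictlyGE a) (_ : K.IsStrictlyLE b),
      Nonempty (X ≅ Bounded.ofComplex K a b) := by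
  obtain ⟨⟨a, ha⟩, ⟨b, hb⟩⟩ := X.property
  obtain ⟨K, _, _, ⟨e⟩⟩ := exists_iso_Q_obj_of_isGE_of_isLE X.obj a b
  exact ⟨K, a, b, inferInstance, inferInstance, ⟨Bounded.ι.preimageIso e⟩⟩

variable (F : C ⥤ C') [F.Additive] [PreservesFiniteLimits F] [PreservesFiniteColimits F]

/-- The functor induced by an exact functor between bounded derived categories. -/
noncomputable def Bounded.map : Bounded C ⥤ Bounded C' :=
  ObjectProperty.lift _ (Bounded.ι ⋙ F.mapDerivedCategory) fun X => by
    obtain ⟨K, a, b, _, _, ⟨e⟩⟩ := X.exists_iso_ofComplex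
    have := CochainComplex.isStrictlyGE_map F K a
    have := CochainComplex.isStrictlyLE_map F K b
    exact prop_of_iso _ (((Bounded.ι ⋙ F.mapDerivedCategory).mapIso e).trans
      (F.mapDerivedCategoryFactors.app K)).symm
      (Bounded.ofComplex ((F.mapHomologicalComplex (ComplexShape.up ℤ)).obj K) a b).property

noncomputable instance : (Bounded.map F).CommShift ℤ :=
  inferInstanceAs ((ObjectProperty.lift _ (Bounded.ι ⋙ F.mapDerivedCategory) _).CommShift ℤ)

instance : (Bounded.map F).IsTriangulated :=
  inferInstanceAs ((ObjectProperty.lift _ (Bounded.ι ⋙ F.mapDerivedCategory) _).IsTriangulated)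

/-- The functor induced by an exact functor is computed on complexes termwise. -/
noncomputable def Bounded.mapOfComplexIso (K : CochainComplex C ℤ) (a b : ℤ) [K.IsStrictlyGE a]
    [K.IsStrictlyLE b]
    [CochainComplex.IsStrictlyGE ((F.mapHomologicalComplex (ComplexShape.up ℤ)).obj K) a]
    [CochainComplex.IsStrictlyLE ((F.mapHomologicalComplex (ComplexShape.up ℤ)).obj K) b] :
    (Bounded.map F).obj (Bounded.ofComplex K a b) ≅
      Bounded.ofComplex ((F.mapHomologicalComplex (ComplexShape.up ℤ)).obj K) a b :=
  Bounded.ι.preimageIso (F.mapDerivedCategoryFactors.app K)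

theorem Bounded.exists_distTriang {S : ShortComplex (CochainComplex C ℤ)} (hS : S.ShortExact)
    (a b : ℤ) [S.X₁.IsStrictlyGE a] [S.X₁.IsStrictlyLE b] [S.X₂.IsStrictlyGE a]
    [S.X₂.IsStrictlyLE b] [S.X₃.IsStrictlyGE a] [S.X₃.IsStrictlyLE b] :
    ∃ T ∈ distTriang (Bounded C), T.obj₁ = Bounded.ofComplex S.X₁ a b ∧
      T.obj₂ = Bounded.ofComplex S.X₂ a b ∧ T.obj₃ = Bounded.ofComplex S.X₃ a b := by
  obtain ⟨f, g, h, hT⟩ := TStructure.t.bounded.exists_distTriang_fullSubcategory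
    (Bounded.ofComplex S.X₁ a b) (Bounded.ofComplex S.X₂ a b) (Bounded.ofComplex S.X₃ a b)
    _ _ _ (triangleOfSES_distinguished hS)
  exact ⟨_, hT, rfl, rfl, rfl⟩

end DerivedCategory

end Filtration

/-! ### The projection from `K` to `K ⧸ IK` and its kernel. -/

section QuotientFunctors

open Limits

namespace CochainComplex

theorem isStrictlyGE_kernel {C : Type*} [Category* C] [Abelian C] {K L : CochainComplex C ℤ}
    (f : K ⟶ L) (a : ℤ) [K.IsStrictlyGE a] : (kernel f).IsStrictlyGE a := by
  rw [isStrictlyGE_iff]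
  exact fun i hi => IsZero.of_mono ((kernel.ι f).f i) (K.isZero_of_isStrictlyGE a i hi)

theorem isStrictlyLE_kernel {C : Type*} [Category* C] [Abelian C] {K L : CochainComplex C ℤ}
    (f : K ⟶ L) (a : ℤ) [K.IsStrictlyLE a] : (kernel f).IsStrictlyLE a := by
  rw [isStrictlyLE_iff]
  exact fun i hi => IsZero.of_mono ((kernel.ι f).f i) (K.isZero_of_isStrictlyLE a i hi)

end CochainComplex

namespace FGModuleCat

variable {R : Type u} [CommRing R] (I : Ideal R)

theorem isZero_of_subsingleton (M : FGModuleCat.{u} R) (h : ∀ x : M, x = 0) : IsZero M := by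
  rw [IsZero.iff_id_eq_zero]
  ext x
  exact h x

variable [IsNoetherianRing R]

/-- Restriction of scalars of finitely generated modules along `R → R ⧸ I`. -/
noncomputable def restrictQuotient : FGModuleCat.{u} (R ⧸ I) ⥤ FGModuleCat.{u} R :=
  ObjectProperty.lift _
    (forget₂ (FGModuleCat.{u} (R ⧸ I)) (ModuleCat.{u} (R ⧸ I)) ⋙
      ModuleCat.restrictScalars (Ideal.Quotient.mk I))
    fun M => by
      let _ : Module R M := Module.compHom M (Ideal.Quotient.mk I)
      have : IsScalarTower R (R ⧸ I) M := IsScalarTower.of_algebraMap_smul fun _ _ => rfl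
      exact Module.Finite.trans (R := R) (R ⧸ I) M

instance : (restrictQuotient I).Additive where

instance : PreservesFiniteLimits (restrictQuotient I) := by
  have : PreservesFiniteLimits (restrictQuotient I ⋙
      forget₂ (FGModuleCat.{u} R) (ModuleCat.{u} R)) :=
    inferInstanceAs (PreservesFiniteLimits
      (forget₂ (FGModuleCat.{u} (R ⧸ I)) (ModuleCat.{u} (R ⧸ I)) ⋙
        ModuleCat.restrictScalars (Ideal.Quotient.mk I)))
  exact preservesFiniteLimits_of_reflects_of_preserves _
    (forget₂ (FGModuleCat.{u} R) (ModuleCat.{u} R))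

instance : PreservesFiniteColimits (restrictQuotient I) := by
  have : PreservesFiniteColimits (restrictQuotient I ⋙
      forget₂ (FGModuleCat.{u} R) (ModuleCat.{u} R)) :=
    inferInstanceAs (PreservesFiniteColimits
      (forget₂ (FGModuleCat.{u} (R ⧸ I)) (ModuleCat.{u} (R ⧸ I)) ⋙
        ModuleCat.restrictScalars (Ideal.Quotient.mk I)))
  exact preservesFiniteColimits_of_reflects_of_preserves _
    (forget₂ (FGModuleCat.{u} R) (ModuleCat.{u} R))

/-- The map `M ⧸ IM → N ⧸ IN` induced by a linear map `M → N`. -/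
noncomputable def quotientMap {M N : Type*} [AddCommGroup M] [Module R M] [AddCommGroup N]
    [Module R N] (f : M →ₗ[R] N) :
    (M ⧸ (I • ⊤ : Submodule R M)) →ₗ[R ⧸ I] (N ⧸ (I • ⊤ : Submodule R N)) :=
  LinearMap.extendScalarsOfSurjective (R := R) Ideal.Quotient.mk_surjective
    (Submodule.mapQ _ _ f (Submodule.smul_top_le_comap_smul_top I f))

instance finite_quotient (M : Type*) [AddCommGroup M] [Module R M] [Module.Finite R M] :
    Module.Finite (R ⧸ I) (M ⧸ (I • ⊤ : Submodule R M)) :=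
  Module.Finite.of_restrictScalars_finite R _ _

/-- The functor `M ↦ M ⧸ IM` on finitely generated modules. -/
noncomputable def quotient : FGModuleCat.{u} R ⥤ FGModuleCat.{u} (R ⧸ I) where
  obj M := FGModuleCat.of (R ⧸ I) (M ⧸ (I • ⊤ : Submodule R M))
  map {M N} f := FGModuleCat.ofHom (quotientMap (M := M) (N := N) I f.hom.hom)
  map_id M := FGModuleCat.hom_ext (LinearMap.ext fun x => by
    obtain ⟨x, rfl⟩ := Submodule.Quotient.mk_surjective _ x
    rfl)
  map_comp f g := FGModuleCat.hom_ext (LinearMap.ext fun x => by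
    obtain ⟨x, rfl⟩ := Submodule.Quotient.mk_surjective _ x
    rfl)

instance : (quotient I).Additive where
  map_add {M N f g} := FGModuleCat.hom_ext (LinearMap.ext fun x => by
    obtain ⟨x, rfl⟩ := Submodule.Quotient.mk_surjective _ x
    rfl)

/-- The natural projection `M → M ⧸ IM`. -/
noncomputable def quotientUnit : 𝟭 (FGModuleCat.{u} R) ⟶ quotient I ⋙ restrictQuotient I where
  app M := InducedCategory.homMk (ModuleCat.ofHom
    (Y := (ModuleCat.restrictScalars (Ideal.Quotient.mk I)).obj ((quotient I).obj M).obj)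
    { toFun := Submodule.Quotient.mk
      map_add' := fun _ _ => rfl
      map_smul' := fun _ _ => rfl })
  naturality _ _ _ := rfl

instance (M : FGModuleCat.{u} R) : Epi ((quotientUnit I).app M) :=
  (epi_iff_surjective _).2 (Submodule.mkQ_surjective (I • ⊤ : Submodule R M))

theorem injective_of_mono {M N : FGModuleCat.{u} R} (f : M ⟶ N) [Mono f] :
    Function.Injective f.hom.hom :=
  (ModuleCat.mono_iff_injective ((forget₂ (FGModuleCat R) (ModuleCat R)).map f)).1 inferInstance

/-- The projection `K → K ⧸ IK` of complexes. -/
noncomputable def quotientComplexMap (K : CochainComplex (FGModuleCat.{u} R) ℤ) :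
    K ⟶ ((restrictQuotient I).mapHomologicalComplex (ComplexShape.up ℤ)).obj
      (((quotient I).mapHomologicalComplex (ComplexShape.up ℤ)).obj K) where
  f i := (quotientUnit I).app (K.X i)
  comm' i j _ := ((quotientUnit I).naturality (K.d i j)).symm

instance (K : CochainComplex (FGModuleCat.{u} R) ℤ) : Epi (quotientComplexMap I K) := by
  have (i : ℤ) : Epi ((quotientComplexMap I K).f i) :=
    inferInstanceAs (Epi ((quotientUnit I).app (K.X i)))
  exact HomologicalComplex.epi_of_epi_f _ inferInstance

/-- The ideal `J` annihilates all terms of the complex `K`. -/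
def IsAnnihilatedBy (J : Ideal R) (K : CochainComplex (FGModuleCat.{u} R) ℤ) : Prop :=
  ∀ (i : ℤ), ∀ r ∈ J, ∀ x : K.X i, r • x = 0

/-- Termwise, the kernel embeds in `IK`, whose elements are sums of `a • m` with `a ∈ I`;
multiplying by `r ∈ J` lands in `(I * J)K = 0`. -/
theorem isAnnihilatedBy_kernel (J : Ideal R) (K : CochainComplex (FGModuleCat.{u} R) ℤ)
    (hK : IsAnnihilatedBy (I * J) K) : IsAnnihilatedBy J (kernel (quotientComplexMap I K)) := by
  intro i r hr x
  apply injective_of_mono ((kernel.ι (quotientComplexMap I K)).f i)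
  set y := ((kernel.ι (quotientComplexMap I K)).f i).hom.hom x with hy
  have hy0 : ((quotientUnit I).app (K.X i)).hom.hom y = 0 := by
    have := congrArg (fun f => (f.f i).hom.hom x) (kernel.condition (quotientComplexMap I K))
    exact this
  have hmem : y ∈ (I • ⊤ : Submodule R (K.X i)) := (Submodule.Quotient.mk_eq_zero _).1 hy0
  rw [map_smul, map_zero]
  change r • y = 0
  refine Submodule.smul_induction_on hmem (fun a ha m _ => ?_) (fun a b ha hb => ?_)
  · rw [smul_smul, mul_comm]
    exact hK i _ (Ideal.mul_mem_mul ha hr) m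
  · rw [smul_add, ha, hb, add_zero]

end FGModuleCat

end QuotientFunctors

/-! ### Generation from a vanishing product of ideals. -/

section IdealFiltration

open Limits ZeroObject Pretriangulated ObjectProperty DerivedCategory FGModuleCat

variable {R : Type u} [CommRing R] [IsNoetherianRing R]

universe w

/-- Induction along the triangle `IK → K → K ⧸ IK`. The generator is quantified before `K`, and
starting from `thick^0` allows the empty list. -/
theorem exists_thickLevel_of_isAnnihilatedBy [HasDerivedCategory.{w} (FGModuleCat.{u} R)] (n : ℕ)
    (L : List (Ideal R)) (hL : ∀ I ∈ L, dimDbMod (R ⧸ I) ≤ n) :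
    ∃ G : Bounded (FGModuleCat.{u} R), ∀ (K : CochainComplex (FGModuleCat.{u} R) ℤ) (a b : ℤ)
      [K.IsStrictlyGE a] [K.IsStrictlyLE b], IsAnnihilatedBy L.prod K →
      (ObjectProperty.singleton G).thickLevel (L.length * (n + 1)) (Bounded.ofComplex K a b) := by
  induction L with
  | nil =>
    refine ⟨0, fun K a b _ _ hK => ?_⟩
    have hK' : IsZero K := by
      rw [IsZero.iff_id_eq_zero]
      ext i : 1
      refine (IsZero.iff_id_eq_zero _).1 (isZero_of_subsingleton _ fun x => ?_)
      -- The empty product is the unit ideal, so `1` annihilates every term.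
      simpa using hK i 1 (by simp) x
    rw [List.length_nil, zero_mul]
    have : IsZero (Bounded.ι.obj (Bounded.ofComplex K a b)) := Q.map_isZero hK'
    rw [IsZero.iff_id_eq_zero] at this
    refine (IsZero.iff_id_eq_zero _).2 (Bounded.ι.map_injective ?_)
    exact (Bounded.ι.map_id _).trans (this.trans (Functor.map_zero _ _ _).symm)
  | cons I L ih =>
    obtain ⟨G, hG⟩ := ih fun J hJ => hL J (List.mem_cons_of_mem _ hJ)
    let _ := HasDerivedCategory.standard (FGModuleCat.{u} (R ⧸ I))
    obtain ⟨H, hH⟩ := (rouquierDim_le_iff (C := Bounded (FGModuleCat.{u} (R ⧸ I))) n).1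
      (hL I List.mem_cons_self)
    let F := Bounded.map (restrictQuotient I)
    -- Both the old generator and the restricted generator from `R ⧸ I` are retracts of `G'`.
    let G' := G ⊞ F.obj H
    have hG' : (ObjectProperty.singleton G').triangEnvelopeIter 0 G' :=
      le_triangEnvelopeIter _ 0 _ ((singleton_iff _ _).2 rfl)
    have h₁ : ObjectProperty.singleton G ≤ (ObjectProperty.singleton G').triangEnvelopeIter 0 := by
      intro X hX
      obtain rfl := (singleton_iff _ _).1 hX
      exact prop_of_retract _ ⟨biprod.inl, biprod.fst, by simp⟩ hG'
    have h₂ : ObjectProperty.singleton H ≤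
        ((ObjectProperty.singleton G').triangEnvelopeIter 0).inverseImage F := by
      intro X hX
      obtain rfl := (singleton_iff _ _).1 hX
      exact prop_of_retract ((ObjectProperty.singleton G').triangEnvelopeIter 0)
        (⟨biprod.inr, biprod.snd, biprod.inr_snd⟩ : Retract (F.obj H) G') hG'
    refine ⟨G', fun K a b _ _ hK => ?_⟩
    let K' := ((quotient I).mapHomologicalComplex (ComplexShape.up ℤ)).obj K
    have := CochainComplex.isStrictlyGE_map (quotient I) K a
    have := CochainComplex.isStrictlyLE_map (quotient I) K b
    have := CochainComplex.isStrictlyGE_map (restrictQuotient I) K' a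
    have := CochainComplex.isStrictlyLE_map (restrictQuotient I) K' b
    have := CochainComplex.isStrictlyGE_kernel (quotientComplexMap I K) a
    have := CochainComplex.isStrictlyLE_kernel (quotientComplexMap I K) b
    let S := ShortComplex.mk (kernel.ι (quotientComplexMap I K)) (quotientComplexMap I K) (by simp)
    have hS : S.ShortExact := { exact := ShortComplex.exact_kernel _ }
    have : S.X₁.IsStrictlyGE a := ‹_›
    have : S.X₁.IsStrictlyLE b := ‹_›
    have : S.X₂.IsStrictlyGE a := ‹_›
    have : S.X₂.IsStrictlyLE b := ‹_›
    have : S.X₃.IsStrictlyGE a := ‹_›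
    have : S.X₃.IsStrictlyLE b := ‹_›
    obtain ⟨T, hT, e₁, e₂, e₃⟩ := Bounded.exists_distTriang hS a b
    have hT₁ : (ObjectProperty.singleton G').thickLevel (L.length * (n + 1)) T.obj₁ := by
      rw [e₁]
      refine thickLevel_le_of_le h₁ _ _ (hG _ a b (isAnnihilatedBy_kernel I _ K ?_))
      rwa [List.prod_cons] at hK
    have hT₃ : (ObjectProperty.singleton G').triangEnvelopeIter n T.obj₃ := by
      rw [e₃]
      refine prop_of_iso _ (Bounded.mapOfComplexIso (restrictQuotient I) K' a b) ?_
      exact triangEnvelopeIter_le_inverseImage F h₂ n _ (hH ▸ trivial)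
    have := (ObjectProperty.singleton G').thickLevel_of_distTriang T hT hT₁ hT₃
    rw [e₂] at this
    rwa [List.length_cons, add_mul, one_mul]

/-- If a product of `m > 0` ideals vanishes, then the bounded derived category of `R` is generated
by those of the quotients by the ideals in `m` times as many steps. -/
theorem dimDbMod_add_one_le_of_list_prod_eq_bot (n : ℕ) (L : List (Ideal R)) (hL₀ : L ≠ [])
    (hL : ∀ I ∈ L, dimDbMod (R ⧸ I) ≤ n) (hprod : L.prod = ⊥) :
    dimDbMod R + 1 ≤ (L.length * (n + 1) : ℕ) := by
  let _ := HasDerivedCategory.standard (FGModuleCat.{u} R)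
  obtain ⟨G, hG⟩ := exists_thickLevel_of_isAnnihilatedBy n L hL
  obtain ⟨m, hm⟩ : ∃ m, L.length * (n + 1) = m + 1 :=
    Nat.exists_eq_add_one_of_ne_zero (by simpa using hL₀)
  rw [hm] at hG ⊢
  have : dimDbMod R ≤ m := by
    refine (rouquierDim_le_iff (C := Bounded (FGModuleCat.{u} R)) m).2 ⟨G, ?_⟩
    ext X
    simp only [Pi.top_apply, Prop.top_eq_true, iff_true]
    obtain ⟨K, a, b, _, _, ⟨e⟩⟩ := X.exists_iso_ofComplex
    refine prop_of_iso _ e.symm (hG K a b ?_)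
    intro i r hr x
    rw [hprod, Ideal.mem_bot] at hr
    rw [hr, zero_smul]
  push_cast
  gcongr

end IdealFiltration

/-! ### Products of minimal primes and the three bounds. -/

section MinimalPrimes

theorem minimalPrimes_nonempty (R : Type*) [CommRing R] [Nontrivial R] :
    Nonempty (minimalPrimes R) := by
  obtain ⟨M, hM⟩ := Ideal.exists_maximal R
  obtain ⟨p, hp, -⟩ := Ideal.exists_minimalPrimes_le (bot_le : (⊥ : Ideal R) ≤ M)
  exact ⟨p, hp⟩

theorem exists_loewyLength_eq_and_pow_eq_bot {A : Type*} [CommRing A] [IsLocalRing A]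
    (h : loewyLength A ≠ ⊤) :
    ∃ n : ℕ, loewyLength A = n ∧ IsLocalRing.maximalIdeal A ^ n = ⊥ := by
  classical
  have hex : ∃ n : ℕ, IsLocalRing.maximalIdeal A ^ n = ⊥ := by
    by_contra! hn
    exact h (by simp [loewyLength, hn])
  refine ⟨Nat.find hex, le_antisymm (iInf_le_of_le _ (iInf_le _ (Nat.find_spec hex))) ?_,
    Nat.find_spec hex⟩
  exact le_iInf₂ fun m hm => by exact_mod_cast Nat.find_min' hex hm

/-- The annihilator of a nonzero `x` lies in an associated prime `q`, minimal by hypothesis. If `x`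
is in the product, it vanishes in the localization at `q`, so some element outside `q` kills it, a
contradiction. -/
theorem prod_minimalPrimes_pow_eq_bot {R : Type*} [CommRing R] [IsNoetherianRing R]
    (h : associatedPrimes R R = minimalPrimes R) [Fintype (minimalPrimes R)]
    (w : minimalPrimes R → ℕ)
    (hw : ∀ p : minimalPrimes R,
      IsLocalRing.maximalIdeal (Localization.AtPrime (p : Ideal R)) ^ w p = ⊥) :
    ∏ p : minimalPrimes R, (p : Ideal R) ^ w p = ⊥ := by
  rw [eq_bot_iff]
  intro x hx
  by_contra hx0
  obtain ⟨p, hp, hle⟩ := exists_le_isAssociatedPrime_of_isNoetherianRing R x hx0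
  obtain ⟨q, rfl⟩ : ∃ q : minimalPrimes R, (q : Ideal R) = p :=
    ⟨⟨p, h ▸ hp⟩, rfl⟩
  have hxp : x ∈ (q : Ideal R) ^ w q :=
    (Ideal.prod_le_inf.trans (Finset.inf_le (Finset.mem_univ q))) hx
  have hmap : algebraMap R (Localization.AtPrime (q : Ideal R)) x = 0 := by
    have := Ideal.mem_map_of_mem (algebraMap R (Localization.AtPrime (q : Ideal R))) hxp
    rw [Ideal.map_pow, Localization.AtPrime.map_eq_maximalIdeal] at this
    exact (Submodule.mem_bot _).1 ((hw q).le this)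
  obtain ⟨c, hc⟩ := (IsLocalization.map_eq_zero_iff (q : Ideal R).primeCompl _ x).1 hmap
  exact c.2 (hle (Submodule.mem_colon_singleton.2 ((Submodule.mem_bot R).2 hc)))

theorem prod_minimalPrimes_eq_bot (R : Type*) [CommRing R] [IsReduced R]
    [Fintype (minimalPrimes R)] : ∏ p : minimalPrimes R, (p : Ideal R) = ⊥ := by
  rw [eq_bot_iff, ← Ideal.zero_eq_bot, ← nilradical_eq_zero R, nilradical,
    ← Ideal.sInf_minimalPrimes]
  exact le_sInf fun p hp => Ideal.prod_le_inf.trans (Finset.inf_le (Finset.mem_univ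
    (⟨p, hp⟩ : minimalPrimes R)))

theorem one_le_iSup_one_add {ι : Type*} [Nonempty ι] (f : ι → ℕ∞) : 1 ≤ ⨆ i, (1 + f i) :=
  le_self_add.trans (le_iSup (fun i => 1 + f i) (Classical.arbitrary ι))

theorem dimDbMod_add_one_le_of_prod_pow_eq_bot (R : Type u) [CommRing R] [IsNoetherianRing R]
    [Nontrivial R] [Fintype (minimalPrimes R)] (w : minimalPrimes R → ℕ)
    (hw : ∑ p, w p ≠ 0) (h : ∏ p : minimalPrimes R, (p : Ideal R) ^ w p = ⊥) :
    dimDbMod R + 1 ≤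
      ((∑ p, w p : ℕ) : ℕ∞) * ⨆ p : minimalPrimes R, (1 + dimDbMod (R ⧸ (p : Ideal R))) := by
  have := minimalPrimes_nonempty R
  have h₁ := one_le_iSup_one_add fun p : minimalPrimes R => dimDbMod (R ⧸ (p : Ideal R))
  have h₂ := le_iSup fun p : minimalPrimes R => 1 + dimDbMod (R ⧸ (p : Ideal R))
  generalize (⨆ p : minimalPrimes R, (1 + dimDbMod (R ⧸ (p : Ideal R)))) = s at h₁ h₂ ⊢
  obtain hs | hs := eq_or_ne s ⊤
  -- Nonvanishing of the exponent sum matters here, since `0 * ⊤ = 0`.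
  · rw [hs, ENat.mul_top (by exact_mod_cast hw)]
    exact le_top
  · lift s to ℕ using hs
    obtain ⟨n, rfl⟩ : ∃ n, s = n + 1 :=
      Nat.exists_eq_add_one_of_ne_zero (Nat.one_le_iff_ne_zero.1 (by exact_mod_cast h₁))
    have key := dimDbMod_add_one_le_of_list_prod_eq_bot (R := R) n
      -- Each `p` is listed `w p` times, so that the length is the exponent sum and every quotient
      -- is by a prime.
      (Finset.univ.toList.flatMap fun p : minimalPrimes R => List.replicate (w p) (p : Ideal R))
    have hlen : (Finset.univ.toList.flatMap fun p : minimalPrimes R =>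
        List.replicate (w p) (p : Ideal R)).length = ∑ p, w p := by
      simp [List.length_flatMap, Finset.sum_map_toList]
    rw [hlen] at key
    have := key ?_ ?_ ?_
    · exact_mod_cast this
    · rw [← List.length_pos_iff_ne_nil, hlen]
      exact Nat.pos_of_ne_zero hw
    · intro I hI
      obtain ⟨p, -, hp⟩ := List.mem_flatMap.1 hI
      obtain rfl := List.eq_of_mem_replicate hp
      have := h₂ p
      rw [Nat.cast_add, Nat.cast_one, add_comm] at this
      exact (ENat.add_le_add_iff_right ENat.one_ne_top).1 this
    · rw [List.flatMap_def, List.prod_flatten, List.map_map, ← h, ← Finset.prod_map_toList]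
      congr 2
      ext p : 1
      simp

/-- Adding `1` on the left replaces the `- 1` on the right and avoids truncated subtraction. -/
theorem proposition1p4 (R : Type u) [CommRing R] [IsNoetherianRing R] [Nontrivial R] :
    (associatedPrimes R R = minimalPrimes R →
      dimDbMod R + 1 ≤
        (∑ᶠ p : minimalPrimes R, loewyLength (Localization.AtPrime (p : Ideal R))) *
          ⨆ p : minimalPrimes R, (1 + dimDbMod (R ⧸ (p : Ideal R)))) ∧
    (IsReduced R →
      dimDbMod R + 1 ≤
        (minimalPrimes R).encard * ⨆ p : minimalPrimes R, (1 + dimDbMod (R ⧸ (p : Ideal R)))) ∧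
    (IsStanleyReisnerRing R →
      ((dimDbMod R + 1 : ℕ∞) : WithBot ℕ∞) ≤
        ((minimalPrimes R).encard : WithBot ℕ∞) * (1 + ringKrullDim R)) := by
  have := minimalPrimes_nonempty R
  have : Fintype (minimalPrimes R) := (minimalPrimes.finite_of_isNoetherianRing R).fintype
  have hs : (⨆ p : minimalPrimes R, (1 + dimDbMod (R ⧸ (p : Ideal R)))) ≠ 0 :=
    (zero_lt_one.trans_le (one_le_iSup_one_add _)).ne'
  have hred : IsReduced R → dimDbMod R + 1 ≤
      (minimalPrimes R).encard * ⨆ p : minimalPrimes R, (1 + dimDbMod (R ⧸ (p : Ideal R))) := by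
    intro _
    have := dimDbMod_add_one_le_of_prod_pow_eq_bot R (fun _ => 1)
      (by rw [← Fintype.card_eq_sum_ones]; exact Fintype.card_ne_zero)
      (by simpa using prod_minimalPrimes_eq_bot R)
    rwa [← Fintype.card_eq_sum_ones, ← ENat.card_eq_coe_fintype_card, ENat.card_coe_set_eq] at this
  refine ⟨fun h => ?_, hred, fun h => ?_⟩
  · rw [finsum_eq_sum_of_fintype]
    -- An infinite Loewy length makes the right side `⊤`, since the supremum is nonzero; finiteness
    -- need not be proved.
    by_cases htop : ∃ p : minimalPrimes R, loewyLength (Localization.AtPrime (p : Ideal R)) = ⊤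
    · obtain ⟨p, hp⟩ := htop
      have : ∑ p : minimalPrimes R, loewyLength (Localization.AtPrime (p : Ideal R)) = ⊤ :=
        top_le_iff.1 (hp ▸ Finset.single_le_sum
          (f := fun p : minimalPrimes R => loewyLength (Localization.AtPrime (p : Ideal R)))
          (fun _ _ => zero_le) (Finset.mem_univ p))
      rw [this, ENat.top_mul hs]
      exact le_top
    · push Not at htop
      choose w hw hpow using fun p => exists_loewyLength_eq_and_pow_eq_bot (htop p)
      simp_rw [hw]
      rw [← Nat.cast_sum]
      refine dimDbMod_add_one_le_of_prod_pow_eq_bot R w (fun h0 => ?_)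
        (prod_minimalPrimes_pow_eq_bot h w hpow)
      -- A zero exponent would make the unit ideal of a local ring vanish.
      obtain ⟨p⟩ := ‹Nonempty (minimalPrimes R)›
      have := hpow p
      rw [Finset.sum_eq_zero_iff.1 h0 p (Finset.mem_univ p), pow_zero, Ideal.one_eq_top] at this
      exact top_ne_bot this
  · obtain ⟨d, hd⟩ : ∃ d : ℕ∞, ringKrullDim R = d :=
      (WithBot.ne_bot_iff_exists.1
        (ringKrullDim_nonneg_of_nontrivial.trans_lt' (WithBot.bot_lt_coe _)).ne').imp
        fun _ => Eq.symm
    have hle : ⨆ p : minimalPrimes R, (1 + dimDbMod (R ⧸ (p : Ideal R))) ≤ 1 + d := by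
      refine iSup_le fun p => ?_
      obtain ⟨k, _, m, ⟨e⟩⟩ := h.exists_quotient_minimalPrime_equiv p.2
      have h₁ : ringKrullDim (R ⧸ (p : Ideal R)) = m := by
        rw [ringKrullDim_eq_of_ringEquiv e, MvPolynomial.ringKrullDim_of_isNoetherianRing]
        simp
      have h₂ := ringKrullDim_quotient_le (p : Ideal R)
      rw [h₁, hd] at h₂
      gcongr
      exact (dimDbMod_le_of_ringEquiv_mvPolynomial _ k m e).trans (by exact_mod_cast h₂)
    rw [hd]
    have := (hred h.isReduced).trans (mul_le_mul_right hle _)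
    exact_mod_cast this

end MinimalPrimes
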